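/- Let $X$ be a real Banach space, regarded as a subspace of its bidual $X^{**}$ through the canonical embedding. An operator $G\colon X\rightrightarrows X^*$ is identified with its graph $G\subseteq X\times X^*$. Its Fitzpatrick function is $$F_G(x,x^*)=\sup_{(a,a^*)\in G}\big(\langle x,a^*\rangle+\langle a,x^*\rangle-\langle a,a^*\rangle\big),\qquad (x,x^*)\in X\times X^*.$$ For $F\colon X\times X^*\to[-\infty,+\infty]$, the Fenchel conjugate is the function on $X^*\times X^{**}$ given by $$F^*(x^*,x^{**})=\sup_{(y,y^*)\in X\times X^*}\big(\langle x^*,y\rangle+\langle x^{**},y^*\rangle-F(y,y^*)\big),$$ and $F$ is autoconjugate if $F(x,x^*)=F^*(x^*,x)$ for all $(x,x^*)\in X\times X^*$. The Bauschke–Wang function of a monotone operator $G\neq\varnothing$ is $$\mathcal B_G(x,x^*)=\inf_{(y,y^*)\in X\times X^*}\Big\{\tfrac12F_G(x+y,x^*+y^*)+\tfrac12F_G^*(x^*-y^*,x-y)+\tfrac12\|y\|^2+\tfrac12\|y^*\|^2\Big\}.$$ An operator $G$ is skew if $G$ is a linear subspace and $\langle x,y^*\rangle=-\langle y,x^*\rangle$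 for all $(x,x^*),(y,y^*)\in G$. **Theorem 4.8.** Let $A\colon X^*\to X^{**}$ be linear and continuous with $\operatorname{ran}A\subseteq X$, and let $e\in X^{**}\setminus X$ satisfy $\|e\|<\frac1{\sqrt2}$ and $$\langle Ax^*,x^*\rangle=\langle e,x^*\rangle^2\qquad\text{for all }x^*\in X^*.$$ Let $S=\frac12A-\frac12A^*$ be the skew part of $A$, where $A^*\colon X^*\to X^{**}$ is given by $\langle A^*x^*,y^*\rangle=\langle Ay^*,x^*\rangle$. Put $\{e\}_\bot=\{x^*\in X^*:\langle e,x^*\rangle=0\}$, and let $T\colon X\rightrightarrows X^*$ be the operator with graph $$\operatorname{gra}T=\{(-Sx^*,x^*) : x^*\in\{e\}_\bot,\ Sx^*\in X\}.$$ Then $\operatorname{gra}T=\{(-Ax^*,x^*) : x^*\in\{e\}_\bot\}$, the operator $T$ is skew and maximally monotone, and $$\mathcal B_T(-Aa^*,a^*)>\mathcal B_T^*(a^*,-Aa^*)\qquad\text{for all }a^*\in X^*\setminus\{e\}_\bot .$$ In consequence, $\mathcal B_T$ is not autoconjugate. **Instance on $c_0$.** Let $X=c_0$ with the supremum norm, so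 that $X^*=\ell^1$ and $X^{**}=\ell^\infty$, and let $\alpha=(\alpha_n)\in\ell^\infty$ satisfy $\limsup_n\alpha_n\neq0$ and $\|\alpha\|_\infty<\frac1{\sqrt2}$. Then the operator $A_\alpha\colon\ell^1\to\ell^\infty$, $$(A_\alpha x^*)_n=\alpha_n^2x^*_n+2\sum_{i>n}\alpha_n\alpha_ix^*_i ,$$ is linear and continuous with range in $c_0$, and with $e=\alpha$ it satisfies all the hypotheses above. The associated operator $T_\alpha$ has graph $$\Big\{\Big(\big(-\sum_{i>n}\alpha_n\alpha_ix^*_i+\sum_{i<n}\alpha_n\alpha_ix^*_i\big)_n,\;x^*\Big) : x^*\in\ell^1,\ \sum_i\alpha_ix^*_i=0\Big\}$$ and is skew and maximally monotone. Moreover $\mathcal B_{T_\alpha}(-A_\alpha a^*,a^*)>\mathcal B_{T_\alpha}^*(a^*,-A_\alpha a^*)$ for every $a^*\in\ell^1$ with $\sum_i\alpha_ia^*_i\neq0$, and $\mathcal B_{T_\alpha}$ is not autoconjugate. -/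

import Mathlib

set_option maxSynthPendingDepth 3

open Filter Topology
open scoped ZeroAtInfty

namespace AutoconjugateRepresenter

noncomputable section

/-- The canonical embedding `X → X**`, by which `X` is regarded as a subspace of its bidual. -/
abbrev toBidual (X : Type*) [NormedAddCommGroup X] [NormedSpace ℝ X] :
    X →L[ℝ] StrongDual ℝ (StrongDual ℝ X) :=
  NormedSpace.inclusionInDoubleDual ℝ X

/-- The set `D_⊥ = {x | ⟨x, x*⟩ = 0 for all x* ∈ D}`, for `D ⊆ X*`. -/
def preAnnihilator {X : Type*} [NormedAddCommGroup X] [NormedSpace ℝ X]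
    (D : Set (StrongDual ℝ X)) : Set X :=
  {x | ∀ p ∈ D, p x = 0}

section Operators

/-! A set-valued operator `X ⇉ X*` is represented by its graph, a subset of `X × X*`. -/

variable {X : Type*} [NormedAddCommGroup X] [NormedSpace ℝ X]

/-- Monotonicity of the operator with graph `G`. -/
def IsMonotoneOp (G : Set (X × StrongDual ℝ X)) : Prop :=
  ∀ a ∈ G, ∀ b ∈ G, 0 ≤ (a.2 - b.2) (a.1 - b.1)

/-- Maximal monotonicity: monotone, with no proper monotone extension. -/
def IsMaximallyMonotoneOp (G : Set (X × StrongDual ℝ X)) : Prop :=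
  IsMonotoneOp G ∧ ∀ H : Set (X × StrongDual ℝ X), IsMonotoneOp H → G ⊆ H → H = G

/-- The graph of the adjoint operator `X** ⇉ X*`, that is, the set of the pairs `(x**, x*)` for
which `(x*, -x**)` annihilates `G`. -/
def adjointGraph (G : Set (X × StrongDual ℝ X)) :
    Set (StrongDual ℝ (StrongDual ℝ X) × StrongDual ℝ X) :=
  {q | ∀ a ∈ G, q.2 a.1 + (-q.1) a.2 = 0}

/-- A skew operator: a linear relation whose graph lies in the graph of minus its adjoint
(`(x, x*) ∈ gra (-A*)` means that `(x, -x*) ∈ gra A*`). -/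
def IsSkewOp (G : Set (X × StrongDual ℝ X)) : Prop :=
  (∃ V : Submodule ℝ (X × StrongDual ℝ X), (V : Set (X × StrongDual ℝ X)) = G) ∧
    ∀ a ∈ G, (toBidual X a.1, -a.2) ∈ adjointGraph G

/-- The adjoint of a continuous linear `A : X* → X**`, restricted to `X* ⊆ X***`:
`⟨A* x*, y*⟩ = ⟨x*, A y*⟩`. -/
def adjointOnDual (A : StrongDual ℝ X →L[ℝ] StrongDual ℝ (StrongDual ℝ X)) :
    StrongDual ℝ X →L[ℝ] StrongDual ℝ (StrongDual ℝ X) :=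
  A.flip

/-- For `A : X* → X**`, the values of the adjoint (in the sense of `adjointGraph`, over the space
`X*`) at a point of `X* ⊆ X***` consist of the value of `adjointOnDual A` alone. -/
theorem mem_adjointGraph_iff (A : StrongDual ℝ X →L[ℝ] StrongDual ℝ (StrongDual ℝ X))
    (x : StrongDual ℝ X) (w : StrongDual ℝ (StrongDual ℝ X)) :
    (toBidual (StrongDual ℝ X) x, w) ∈ adjointGraph {a | a.2 = A a.1} ↔
      w = adjointOnDual A x := by
  constructor
  · intro h
    ext y
    have := h (y, A y) rfl
    simp only [neg_apply, NormedSpace.dual_def] at this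
    simp only [adjointOnDual, ContinuousLinearMap.flip_apply]
    linarith
  · rintro rfl ⟨y, z⟩ hz
    obtain rfl : z = A y := hz
    simp [adjointOnDual, NormedSpace.dual_def]

/-- The skew part `S = ½ A - ½ A*` of `A : X* → X**`, as an operator on `X*`. -/
def skewPart (A : StrongDual ℝ X →L[ℝ] StrongDual ℝ (StrongDual ℝ X)) :
    StrongDual ℝ X →L[ℝ] StrongDual ℝ (StrongDual ℝ X) :=
  (1 / 2 : ℝ) • A - (1 / 2 : ℝ) • adjointOnDual A

/-- The operator `T : X ⇉ X*` with graph `{(-S x*, x*) | ⟨e, x*⟩ = 0}`, where `S` is the skew part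
of `A` and the first entry is read in `X ⊆ X**`. -/
def opT (A : StrongDual ℝ X →L[ℝ] StrongDual ℝ (StrongDual ℝ X))
    (e : StrongDual ℝ (StrongDual ℝ X)) : Set (X × StrongDual ℝ X) :=
  {a | toBidual X a.1 = -(skewPart A a.2) ∧ a.2 ∈ preAnnihilator {e}}

end Operators

section Functions

/-- The Fenchel conjugate `f*(x*) = sup_x (⟨x*, x⟩ - f x)`. -/
def fenchelConjugate {E : Type*} [NormedAddCommGroup E] [NormedSpace ℝ E]
    (f : E → EReal) (p : StrongDual ℝ E) : EReal :=
  ⨆ x : E, ((p x : ℝ) : EReal) - f x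

variable {X : Type*} [NormedAddCommGroup X] [NormedSpace ℝ X]

/-- The Fenchel conjugate of a function on `X × X*`, as a function on `X* × X**`, the dual of
`X × X*` under the pairing `⟨(x*, x**), (x, y*)⟩ = ⟨x*, x⟩ + ⟨x**, y*⟩`. -/
def pairConjugate (F : X × StrongDual ℝ X → EReal)
    (q : StrongDual ℝ X × StrongDual ℝ (StrongDual ℝ X)) : EReal :=
  fenchelConjugate F (q.1.coprod q.2)

/-- The restriction to `X × X*` of the transposed conjugate: `(x, x*) ↦ F*(x*, x)`. -/
def transposedConjugate (F : X × StrongDual ℝ X → EReal) (a : X × StrongDual ℝ X) : EReal :=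
  pairConjugate F (a.2, toBidual X a.1)

/-- `F` is autoconjugate if `F(x, x*) = F*(x*, x)` on `X × X*`. -/
def IsAutoconjugate (F : X × StrongDual ℝ X → EReal) : Prop :=
  ∀ a, F a = transposedConjugate F a

/-- The Fitzpatrick function
`F_G(x, x*) = sup_{(a, a*) ∈ G} (⟨x, a*⟩ + ⟨a, x*⟩ - ⟨a, a*⟩)`. -/
def fitzpatrick (G : Set (X × StrongDual ℝ X)) (p : X × StrongDual ℝ X) : EReal :=
  ⨆ a ∈ G, ((a.2 p.1 + p.2 a.1 - a.2 a.1 : ℝ) : EReal)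

/-- The Bauschke–Wang function
`B_G(x, x*) = inf_{(y, y*)} (½ F_G(x+y, x*+y*) + ½ F_G*(x*-y*, x-y) + ½ ‖y‖² + ½ ‖y*‖²)`.
For a monotone operator with nonempty graph neither `F_G` nor its conjugate takes the
value `-∞`, so the sum never has the form `∞ - ∞`. -/
def bauschkeWang (G : Set (X × StrongDual ℝ X)) (p : X × StrongDual ℝ X) : EReal :=
  ⨅ y : X × StrongDual ℝ X,
    ((1 / 2 : ℝ) : EReal) * fitzpatrick G (p + y) +
      ((1 / 2 : ℝ) : EReal) * transposedConjugate (fitzpatrick G) (p - y) +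
      ((1 / 2 * ‖y.1‖ ^ 2 + 1 / 2 * ‖y.2‖ ^ 2 : ℝ) : EReal)

end Functions

/-- The `n`-th unit vector of `c₀`, the space of real null sequences (as `C₀(ℕ, ℝ)`, with the
supremum norm). -/
def unitVec (n : ℕ) : C₀(ℕ, ℝ) where
  toFun := Pi.single n 1
  continuous_toFun := continuous_of_discreteTopology
  zero_at_infty' := by
    rw [cocompact_eq_cofinite]
    refine tendsto_const_nhds.congr' ?_
    filter_upwards [(Set.finite_singleton n).compl_mem_cofinite] with m hm
    have hmn : m ≠ n := by simpa using hm
    simp [hmn]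

/-- The `n`-th coordinate `x*_n` of `x* ∈ (c₀)*`; the map `x* ↦ (x*_n)` is the standard isometric
identification of `(c₀)*` with `ℓ¹`. -/
def coord (x : StrongDual ℝ C₀(ℕ, ℝ)) (n : ℕ) : ℝ :=
  x (unitVec n)

end

end AutoconjugateRepresenter

open AutoconjugateRepresenter

/-! Polarizing `⟨Ax, x⟩ = ⟨e, x⟩²` gives `⟨Ax, y⟩ + ⟨Ay, x⟩ = 2⟨e, x⟩⟨e, y⟩`, so `S = A - ⟨e, ·⟩e`
and `A` is skew as soon as one argument lies in `ker e`. The crux is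
`toBidual_eq_neg_of_forall_mem_opT`: if `(x, x*)` annihilates `gra T`, then `x + Ax*` vanishes on
`ker e`, hence is a multiple of `e`; it lies in `X` and `e` does not, so it is zero. Maximality of
`T` follows.

By linearity `F_T` is then the indicator of `gra(-A)`, while its transposed conjugate is nonnegative
and infinite off `gra T`. So in the infimum defining `B_T(p)` only those `y` count for which `p + y
∈ gra(-A)` and `p - y ∈ gra T`. These force `p ∈ gra(-A)` and `⟨e, y*⟩ = ⟨e, p*⟩`, and `½‖y*‖²`
alone contributes at least `⟨e, p*⟩² / (2‖e‖²)`. Conjugating this bound gives `B_T*(a*, -Aa*) ≤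
2‖e‖²⟨e, a*⟩²`, and `2‖e‖² < 1 < 1 / (2‖e‖²)` separates the two values.

On `c₀` the quadratic identity is the square of a convergent series, obtained by telescoping squares
of tails (`eq_tsum_sq_of_hasSum`). -/

namespace AutoconjugateRepresenter

/-! ### The general theorem: `T`, its Fitzpatrick function and its Bauschke–Wang function -/

section General

variable {X : Type*} [NormedAddCommGroup X] [NormedSpace ℝ X]

theorem toBidual_injective : Function.Injective (toBidual X) :=
  (NormedSpace.inclusionInDoubleDualLi ℝ (E := X)).injective

theorem mem_preAnnihilator_singleton {e : StrongDual ℝ X} {x : X} :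
    x ∈ preAnnihilator {e} ↔ e x = 0 := by
  simp [preAnnihilator]

variable {A : StrongDual ℝ X →L[ℝ] StrongDual ℝ (StrongDual ℝ X)}
  {e : StrongDual ℝ (StrongDual ℝ X)}

theorem apply_add_apply_swap (hq : ∀ x, A x x = (e x) ^ 2) (x y : StrongDual ℝ X) :
    A x y + A y x = 2 * e x * e y := by
  have h := hq (x + y)
  simp only [map_add, add_apply] at h
  linarith [hq x, hq y]

theorem skewPart_apply (hq : ∀ x, A x x = (e x) ^ 2) (x : StrongDual ℝ X) :
    skewPart A x = A x - e x • e := by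
  ext y
  have h := apply_add_apply_swap hq x y
  simp only [skewPart, adjointOnDual, sub_apply, smul_apply, ContinuousLinearMap.flip_apply,
    smul_eq_mul]
  linarith

theorem opT_eq (hq : ∀ x, A x x = (e x) ^ 2) :
    opT A e = {a | toBidual X a.1 = -(A a.2) ∧ a.2 ∈ preAnnihilator {e}} := by
  ext ⟨x, a⟩
  simp only [opT, Set.mem_ofPred_eq, mem_preAnnihilator_singleton, skewPart_apply hq]
  refine and_congr_left fun h => ?_
  rw [h, zero_smul, sub_zero]

theorem mem_opT_iff (hq : ∀ x, A x x = (e x) ^ 2) {a : X × StrongDual ℝ X} :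
    a ∈ opT A e ↔ toBidual X a.1 = -(A a.2) ∧ e a.2 = 0 := by
  rw [opT_eq hq, Set.mem_ofPred_eq, mem_preAnnihilator_singleton]

theorem apply_fst_of_toBidual_eq {x : X} {a : StrongDual ℝ X} (h : toBidual X x = -(A a))
    (b : StrongDual ℝ X) : b x = -(A a b) := by
  simpa using DFunLike.congr_fun h b

theorem isSkewOp_opT (hq : ∀ x, A x x = (e x) ^ 2) : IsSkewOp (opT A e) := by
  refine ⟨⟨{ carrier := opT A e, add_mem' := ?_, zero_mem' := ?_, smul_mem' := ?_ }, rfl⟩, ?_⟩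
  · intro a b ha hb
    rw [mem_opT_iff hq] at *
    simp [ha.1, ha.2, hb.1, hb.2, add_comm]
  · simp [mem_opT_iff hq]
  · intro c a ha
    rw [mem_opT_iff hq] at *
    simp [ha.1, ha.2]
  · intro a ha b hb
    rw [mem_opT_iff hq] at ha hb
    have h := apply_add_apply_swap hq a.2 b.2
    rw [ha.2] at h
    simp only [neg_apply, NormedSpace.dual_def, apply_fst_of_toBidual_eq ha.1,
      apply_fst_of_toBidual_eq hb.1, map_neg]
    linarith

theorem apply_fst_eq_zero_of_mem_opT (hq : ∀ x, A x x = (e x) ^ 2) {a : X × StrongDual ℝ X}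
    (ha : a ∈ opT A e) : a.2 a.1 = 0 := by
  rw [mem_opT_iff hq] at ha
  rw [apply_fst_of_toBidual_eq ha.1, hq, ha.2]
  simp

/-- The elements of `opT A e` annihilate, under the duality pairing, exactly the graph of `-A`. -/
theorem toBidual_eq_neg_of_forall_mem_opT (hA : Set.range A ⊆ Set.range (toBidual X))
    (he : e ∉ Set.range (toBidual X)) (hq : ∀ x, A x x = (e x) ^ 2) {p : X × StrongDual ℝ X}
    (h : ∀ a ∈ opT A e, a.2 p.1 + p.2 a.1 = 0) : toBidual X p.1 = -(A p.2) := by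
  obtain ⟨z, hz⟩ := hA ⟨p.2, rfl⟩
  -- Here `z ∈ X` represents `A p.2`. Pairing `p` with `(-Ax, x) ∈ gra T` and moving `A` across,
  -- with sign change because `e x = 0`, gives the value of `p.1 + z` at `x`.
  have key : ∀ x : StrongDual ℝ X, e x = 0 → toBidual X (p.1 + z) x = 0 := by
    intro x hx
    obtain ⟨w, hw⟩ := hA ⟨x, rfl⟩
    have hw' : toBidual X (-w) = -(A x) := by rw [map_neg, hw]
    have h1 := h (-w, x) ((mem_opT_iff hq).2 ⟨hw', hx⟩)
    have h2 := apply_add_apply_swap hq x p.2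
    have h3 := apply_fst_of_toBidual_eq hw' p.2
    have h4 : x z = A p.2 x := by simpa using DFunLike.congr_fun hz x
    rw [hx] at h2
    rw [NormedSpace.dual_def, map_add]
    linarith
  have hmul : ∃ c : ℝ, toBidual X (p.1 + z) = c • e := by
    have hne : ∃ u, e u ≠ 0 := by
      by_contra! hcon
      exact he ⟨0, by ext u; simp [hcon u]⟩
    obtain ⟨u, hu⟩ := hne
    refine ⟨toBidual X (p.1 + z) u / e u, ?_⟩
    ext x
    have h1 := key (x - (e x / e u) • u) (by simp [hu])
    rw [map_sub, map_smul, smul_eq_mul, sub_eq_zero] at h1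
    rw [h1, smul_apply, smul_eq_mul]
    ring
  obtain ⟨c, hc⟩ := hmul
  have hc0 : c = 0 := by
    by_contra hne
    exact he ⟨c⁻¹ • (p.1 + z), by rw [map_smul, hc, inv_smul_smul₀ hne]⟩
  rw [hc0, zero_smul, map_add, hz] at hc
  exact eq_neg_of_add_eq_zero_left hc

theorem isMaximallyMonotoneOp_opT (hA : Set.range A ⊆ Set.range (toBidual X))
    (he : e ∉ Set.range (toBidual X)) (hq : ∀ x, A x x = (e x) ^ 2) :
    IsMaximallyMonotoneOp (opT A e) := by
  obtain ⟨⟨V, hV⟩, -⟩ := isSkewOp_opT hq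
  refine ⟨fun a ha b hb => ?_, fun H hH hsub => hsub.antisymm' fun p hp => ?_⟩
  · rw [← hV] at ha hb
    have hab := V.sub_mem ha hb
    rw [← SetLike.mem_coe, hV] at hab
    exact (apply_fst_eq_zero_of_mem_opT hq hab).ge
  · have hle : ∀ a ∈ opT A e, a.2 p.1 + p.2 a.1 ≤ p.2 p.1 := by
      intro a ha
      have h1 := hH p hp a (hsub ha)
      have h2 := apply_fst_eq_zero_of_mem_opT hq ha
      simp only [sub_apply, map_sub] at h1
      linarith
    have hzero : ∀ a ∈ opT A e, a.2 p.1 + p.2 a.1 = 0 := by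
      intro a ha
      by_contra hne
      -- The factor makes the pairing equal to `p.2 p.1 + 1`, which violates `hle`.
      have hmem : ((p.2 p.1 + 1) / (a.2 p.1 + p.2 a.1)) • a ∈ opT A e := by
        rw [← hV] at ha ⊢
        exact V.smul_mem _ ha
      have h1 := hle _ hmem
      simp only [Prod.smul_fst, Prod.smul_snd, smul_apply, map_smul, smul_eq_mul,
        ← mul_add] at h1
      rw [div_mul_cancel₀ _ hne] at h1
      linarith
    have hp1 := toBidual_eq_neg_of_forall_mem_opT hA he hq hzero
    -- Testing against the origin gives `0 ≤ p.2 p.1 = -(e p.2)²`, so `e p.2 = 0`.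
    have hpos := hle 0 (by simp [mem_opT_iff hq])
    simp only [Prod.snd_zero, Prod.fst_zero, zero_apply, map_zero, add_zero] at hpos
    rw [apply_fst_of_toBidual_eq hp1, hq] at hpos
    exact (mem_opT_iff hq).2 ⟨hp1, by nlinarith [sq_nonneg (e p.2)]⟩

theorem fitzpatrick_opT_nonneg (hq : ∀ x, A x x = (e x) ^ 2) (p : X × StrongDual ℝ X) :
    0 ≤ fitzpatrick (opT A e) p :=
  le_iSup₂_of_le (0 : X × StrongDual ℝ X) (by simp [mem_opT_iff hq]) (by simp)

theorem fitzpatrick_opT_of_eq (hq : ∀ x, A x x = (e x) ^ 2) {p : X × StrongDual ℝ X}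
    (hp : toBidual X p.1 = -(A p.2)) : fitzpatrick (opT A e) p = 0 := by
  refine le_antisymm (iSup₂_le fun a ha => ?_) (fitzpatrick_opT_nonneg hq p)
  have h0 := apply_fst_eq_zero_of_mem_opT hq ha
  rw [mem_opT_iff hq] at ha
  have h := apply_add_apply_swap hq a.2 p.2
  rw [ha.2] at h
  rw [h0, apply_fst_of_toBidual_eq hp, apply_fst_of_toBidual_eq ha.1, EReal.coe_nonpos]
  linarith

/-- Some element of `gra T` pairs nontrivially with `p`. Its multiples stay in `gra T` and have zero
self-pairing, so the supremum is that of an unbounded linear function. -/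
theorem fitzpatrick_opT_of_ne (hA : Set.range A ⊆ Set.range (toBidual X))
    (he : e ∉ Set.range (toBidual X)) (hq : ∀ x, A x x = (e x) ^ 2) {p : X × StrongDual ℝ X}
    (hp : toBidual X p.1 ≠ -(A p.2)) : fitzpatrick (opT A e) p = ⊤ := by
  have hex : ∃ a ∈ opT A e, a.2 p.1 + p.2 a.1 ≠ 0 := by
    by_contra! hcon
    exact hp (toBidual_eq_neg_of_forall_mem_opT hA he hq hcon)
  obtain ⟨a, ha, hne⟩ := hex
  refine EReal.eq_top_iff_forall_lt _ |>.2 fun r => ?_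
  obtain ⟨⟨V, hV⟩, -⟩ := isSkewOp_opT hq
  have hmem : ((r + 1) / (a.2 p.1 + p.2 a.1)) • a ∈ opT A e := by
    rw [← hV] at ha ⊢
    exact V.smul_mem _ ha
  refine lt_of_lt_of_le ?_ (le_iSup₂_of_le _ hmem le_rfl)
  rw [apply_fst_eq_zero_of_mem_opT hq hmem, EReal.coe_lt_coe_iff]
  simp only [Prod.smul_fst, Prod.smul_snd, smul_apply, map_smul, smul_eq_mul, ← mul_add]
  rw [div_mul_cancel₀ _ hne]
  linarith

/-- Since `F_T` vanishes on `gra(-A)`, such points enter the conjugate with their linear term only.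
-/
theorem le_transposedConjugate_fitzpatrick_opT (hq : ∀ x, A x x = (e x) ^ 2)
    (p : X × StrongDual ℝ X) {y : X × StrongDual ℝ X} (hy : toBidual X y.1 = -(A y.2)) :
    ((p.2 y.1 + y.2 p.1 : ℝ) : EReal) ≤ transposedConjugate (fitzpatrick (opT A e)) p := by
  refine le_iSup_of_le y ?_
  rw [fitzpatrick_opT_of_eq hq hy]
  simp

theorem transposedConjugate_fitzpatrick_opT_nonneg (hq : ∀ x, A x x = (e x) ^ 2)
    (p : X × StrongDual ℝ X) : 0 ≤ transposedConjugate (fitzpatrick (opT A e)) p := by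
  simpa using le_transposedConjugate_fitzpatrick_opT hq p (y := 0) (by simp)

theorem transposedConjugate_fitzpatrick_opT_of_notMem (hA : Set.range A ⊆ Set.range (toBidual X))
    (he : e ∉ Set.range (toBidual X)) (hq : ∀ x, A x x = (e x) ^ 2) {p : X × StrongDual ℝ X}
    (hp : p ∉ opT A e) : transposedConjugate (fitzpatrick (opT A e)) p = ⊤ := by
  have hex : ∃ y : X × StrongDual ℝ X,
      toBidual X y.1 = -(A y.2) ∧ p.2 y.1 + y.2 p.1 ≠ 0 := by
    by_contra! hcon
    have h1 : toBidual X p.1 = -(A p.2) := by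
      refine toBidual_eq_neg_of_forall_mem_opT hA he hq fun a ha => ?_
      rw [add_comm]
      exact hcon a ((mem_opT_iff hq).1 ha).1
    -- Now `p` itself lies on `gra(-A)`; its pairing with itself is `-2(e p.2)²`, which must vanish.
    have h2 := hcon p h1
    rw [apply_fst_of_toBidual_eq h1, hq] at h2
    exact hp ((mem_opT_iff hq).2 ⟨h1, by nlinarith⟩)
  obtain ⟨y, hy, hne⟩ := hex
  refine EReal.eq_top_iff_forall_lt _ |>.2 fun r => ?_
  have hcy : toBidual X (((r + 1) / (p.2 y.1 + y.2 p.1)) • y).1 =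
      -(A (((r + 1) / (p.2 y.1 + y.2 p.1)) • y).2) := by
    simp [hy]
  refine lt_of_lt_of_le ?_ (le_transposedConjugate_fitzpatrick_opT hq p hcy)
  rw [EReal.coe_lt_coe_iff]
  simp only [Prod.smul_fst, Prod.smul_snd, smul_apply, map_smul, smul_eq_mul, ← mul_add]
  rw [div_mul_cancel₀ _ hne]
  linarith

/-- The Bauschke–Wang function of `opT A e` dominates `(e ·)² / (2 ‖e‖²)` on the graph of `-A`
and is infinite elsewhere. -/
theorem le_bauschkeWang_opT (hA : Set.range A ⊆ Set.range (toBidual X))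
    (he : e ∉ Set.range (toBidual X)) (hq : ∀ x, A x x = (e x) ^ 2) {p : X × StrongDual ℝ X}
    {r : EReal} (hr : toBidual X p.1 = -(A p.2) →
      r ≤ ((1 / (2 * ‖e‖ ^ 2) * (e p.2) ^ 2 : ℝ) : EReal)) :
    r ≤ bauschkeWang (opT A e) p := by
  refine le_iInf fun y => ?_
  have hhalf : (0 : EReal) < ((1 / 2 : ℝ) : EReal) := by
    rw [EReal.coe_pos]; norm_num
  have hF : 0 ≤ ((1 / 2 : ℝ) : EReal) * fitzpatrick (opT A e) (p + y) :=
    mul_nonneg hhalf.le (fitzpatrick_opT_nonneg hq _)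
  have hC : 0 ≤ ((1 / 2 : ℝ) : EReal) * transposedConjugate (fitzpatrick (opT A e)) (p - y) :=
    mul_nonneg hhalf.le (transposedConjugate_fitzpatrick_opT_nonneg hq _)
  by_cases h1 : toBidual X (p + y).1 = -(A (p + y).2)
  swap
  · rw [fitzpatrick_opT_of_ne hA he hq h1, EReal.mul_top_of_pos hhalf,
      EReal.top_add_of_ne_bot (EReal.bot_lt_zero.trans_le hC).ne', EReal.top_add_coe]
    exact le_top
  by_cases h2 : p - y ∈ opT A e
  swap
  · rw [transposedConjugate_fitzpatrick_opT_of_notMem hA he hq h2, EReal.mul_top_of_pos hhalf,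
      EReal.add_top_of_ne_bot (EReal.bot_lt_zero.trans_le hF).ne', EReal.top_add_coe]
    exact le_top
  obtain ⟨h2, h3⟩ := (mem_opT_iff hq).1 h2
  -- `p` is the midpoint of `p + y` and `p - y`, both on the linear subspace `gra(-A)`.
  have h4 : toBidual X p.1 = -(A p.2) := by
    have hsum := congrArg₂ (· + ·) h1 h2
    simp only [Prod.fst_add, Prod.snd_add, Prod.fst_sub, Prod.snd_sub, map_add, map_sub] at hsum
    have h2' : (2 : ℝ) • toBidual X p.1 = (2 : ℝ) • -(A p.2) := by
      rw [two_smul, two_smul]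
      convert hsum using 1 <;> abel
    exact smul_right_injective _ (two_ne_zero' ℝ) h2'
  have h5 : e p.2 = e y.2 := by
    simpa [sub_eq_zero] using h3
  refine (hr h4).trans ?_
  refine le_trans ?_ (le_add_of_nonneg_left (add_nonneg hF hC))
  rw [EReal.coe_le_coe_iff, h5]
  have he0 : 0 < ‖e‖ := norm_pos_iff.2 fun h => he ⟨0, by rw [h, map_zero]⟩
  have hbound : (e y.2) ^ 2 ≤ ‖e‖ ^ 2 * ‖y.2‖ ^ 2 := by
    rw [← mul_pow, ← sq_abs]
    exact pow_le_pow_left₀ (abs_nonneg _) (e.le_opNorm y.2) 2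
  have h6 : 1 / (2 * ‖e‖ ^ 2) * (e y.2) ^ 2 ≤ 1 / 2 * ‖y.2‖ ^ 2 := by
    rw [div_mul_eq_mul_div, div_le_iff₀ (by positivity)]
    linarith
  linarith [sq_nonneg ‖y.1‖]

theorem pairConjugate_bauschkeWang_opT_le (hA : Set.range A ⊆ Set.range (toBidual X))
    (he : e ∉ Set.range (toBidual X)) (hq : ∀ x, A x x = (e x) ^ 2) (a : StrongDual ℝ X) :
    pairConjugate (bauschkeWang (opT A e)) (a, -(A a)) ≤
      ((2 * ‖e‖ ^ 2 * (e a) ^ 2 : ℝ) : EReal) := by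
  refine iSup_le fun y => ?_
  have key : ((a y.1 - A a y.2 - 2 * ‖e‖ ^ 2 * (e a) ^ 2 : ℝ) : EReal) ≤
      bauschkeWang (opT A e) y := by
    refine le_bauschkeWang_opT hA he hq fun hy => ?_
    rw [EReal.coe_le_coe_iff, apply_fst_of_toBidual_eq hy]
    have h := apply_add_apply_swap hq a y.2
    have he0 : 0 < ‖e‖ := norm_pos_iff.2 fun h => he ⟨0, by rw [h, map_zero]⟩
    -- On `gra(-A)` the linear term `a y.1 - A a y.2` equals `-2 (e a)(e y.2)`; completing the
    -- square in `e y.2` against the lower bound for `B_T` produces the constant `2‖e‖²`.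
    have hid : 1 / (2 * ‖e‖ ^ 2) * (e y.2) ^ 2 + 2 * ‖e‖ ^ 2 * (e a) ^ 2 + 2 * e a * e y.2 =
        2 * ‖e‖ ^ 2 * (e a + e y.2 / (2 * ‖e‖ ^ 2)) ^ 2 := by
      field_simp
      ring
    have hnn : 0 ≤ 2 * ‖e‖ ^ 2 * (e a + e y.2 / (2 * ‖e‖ ^ 2)) ^ 2 := by positivity
    linarith
  rw [show ((a, -(A a)) : StrongDual ℝ X × StrongDual ℝ (StrongDual ℝ X)).1.coprod
      ((a, -(A a)) : StrongDual ℝ X × StrongDual ℝ (StrongDual ℝ X)).2 y =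
      a y.1 - A a y.2 by simp [sub_eq_add_neg]]
  refine EReal.sub_le_of_le_add' ?_
  calc ((a y.1 - A a y.2 : ℝ) : EReal)
      = ((a y.1 - A a y.2 - 2 * ‖e‖ ^ 2 * (e a) ^ 2 : ℝ) : EReal) +
        ((2 * ‖e‖ ^ 2 * (e a) ^ 2 : ℝ) : EReal) := by
        rw [← EReal.coe_add]; congr 1; ring
    _ ≤ _ := by gcongr

theorem pairConjugate_lt_bauschkeWang_opT (hA : Set.range A ⊆ Set.range (toBidual X))
    (he : e ∉ Set.range (toBidual X)) (hnorm : ‖e‖ < 1 / √2) (hq : ∀ x, A x x = (e x) ^ 2)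
    (x : X) {a : StrongDual ℝ X} (ha : e a ≠ 0) :
    pairConjugate (bauschkeWang (opT A e)) (a, -(A a)) < bauschkeWang (opT A e) (x, a) := by
  refine (pairConjugate_bauschkeWang_opT_le hA he hq a).trans_lt ?_
  refine lt_of_lt_of_le ?_ (le_bauschkeWang_opT hA he hq fun _ => le_rfl)
  rw [EReal.coe_lt_coe_iff]
  have he0 : 0 < ‖e‖ := norm_pos_iff.2 fun h => he ⟨0, by rw [h, map_zero]⟩
  have hlt : 2 * ‖e‖ ^ 2 < 1 := by
    have h1 := pow_lt_pow_left₀ hnorm he0.le two_ne_zero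
    rw [div_pow, Real.sq_sqrt zero_le_two] at h1
    linarith
  have h2 : 1 < 1 / (2 * ‖e‖ ^ 2) := one_lt_one_div (by positivity) hlt
  exact mul_lt_mul_of_pos_right (hlt.trans h2) (by positivity)

theorem opT_properties (hA : Set.range A ⊆ Set.range (toBidual X))
    (he : e ∉ Set.range (toBidual X)) (hnorm : ‖e‖ < 1 / √2) (hq : ∀ x, A x x = (e x) ^ 2) :
    opT A e = {a | toBidual X a.1 = -(A a.2) ∧ a.2 ∈ preAnnihilator {e}} ∧
    IsSkewOp (opT A e) ∧
    IsMaximallyMonotoneOp (opT A e) ∧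
    (∀ a : StrongDual ℝ X, a ∉ preAnnihilator {e} →
      ∃ x : X, toBidual X x = -(A a) ∧
        bauschkeWang (opT A e) (x, a) > pairConjugate (bauschkeWang (opT A e)) (a, -(A a))) ∧
    ¬ IsAutoconjugate (bauschkeWang (opT A e)) := by
  have hgt : ∀ a : StrongDual ℝ X, a ∉ preAnnihilator {e} → ∃ x : X, toBidual X x = -(A a) ∧
      bauschkeWang (opT A e) (x, a) > pairConjugate (bauschkeWang (opT A e)) (a, -(A a)) := by
    intro a ha
    obtain ⟨z, hz⟩ := hA ⟨a, rfl⟩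
    have hx : toBidual X (-z) = -(A a) := by rw [map_neg, hz]
    exact ⟨-z, hx, pairConjugate_lt_bauschkeWang_opT hA he hnorm hq _
      (mt mem_preAnnihilator_singleton.2 ha)⟩
  refine ⟨opT_eq hq, isSkewOp_opT hq, isMaximallyMonotoneOp_opT hA he hq, hgt, fun hauto => ?_⟩
  have hne : ∃ u, e u ≠ 0 := by
    by_contra! hcon
    exact he ⟨0, by ext u; simp [hcon u]⟩
  obtain ⟨u, hu⟩ := hne
  obtain ⟨x, hx, hlt⟩ := hgt u (mt mem_preAnnihilator_singleton.1 hu)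
  rw [hauto (x, u), transposedConjugate, hx] at hlt
  exact lt_irrefl _ hlt

end General

/-! ### Coordinates on `c₀` and its dual -/

section NullSequences

theorem unitVec_apply (n m : ℕ) : unitVec n m = if m = n then 1 else 0 := by
  change (Pi.single n 1 : ℕ → ℝ) m = _
  rw [Pi.single_apply]

theorem finsetSum_smul_unitVec_apply (s : Finset ℕ) (c : ℕ → ℝ) (m : ℕ) :
    (∑ n ∈ s, c n • unitVec n) m = if m ∈ s then c m else 0 := by
  have h : (∑ n ∈ s, c n • unitVec n) m = ∑ n ∈ s, (c n • unitVec n) m := by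
    induction s using Finset.induction_on with
    | empty => simp
    | insert a s ha ih => rw [Finset.sum_insert ha, Finset.sum_insert ha, ← ih]; rfl
  rw [h]
  simp [ZeroAtInftyContinuousMap.smul_apply, unitVec_apply]

theorem c0_norm_le {f : C₀(ℕ, ℝ)} {C : ℝ} (hC : 0 ≤ C) (h : ∀ n, |f n| ≤ C) : ‖f‖ ≤ C := by
  rw [← ZeroAtInftyContinuousMap.norm_toBCF_eq_norm]
  exact (BoundedContinuousFunction.norm_le hC).2 h

theorem c0_tendsto (f : C₀(ℕ, ℝ)) : Tendsto f atTop (𝓝 0) := by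
  have h := f.zero_at_infty'
  rwa [cocompact_eq_cofinite, Nat.cofinite_eq_atTop] at h

/-- Test `x` on the finite sign vector of its coordinates, which has norm at most one. -/
theorem sum_abs_coord_le (x : StrongDual ℝ C₀(ℕ, ℝ)) (s : Finset ℕ) :
    ∑ n ∈ s, |coord x n| ≤ ‖x‖ := by
  have h1 : ∑ n ∈ s, |coord x n| = x (∑ n ∈ s, (SignType.sign (coord x n) : ℝ) • unitVec n) := by
    rw [map_sum]
    refine Finset.sum_congr rfl fun n _ => ?_
    rw [map_smul, smul_eq_mul]
    exact (sign_mul_self (coord x n)).symm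
  rw [h1]
  refine (le_abs_self _).trans ((x.le_opNorm _).trans (mul_le_of_le_one_right (norm_nonneg _) ?_))
  refine c0_norm_le zero_le_one fun n => ?_
  rw [finsetSum_smul_unitVec_apply]
  split_ifs
  · rcases SignType.sign (coord x n) with _ | _ | _ <;> simp
  · simp

theorem summable_abs_coord (x : StrongDual ℝ C₀(ℕ, ℝ)) : Summable fun n => |coord x n| :=
  summable_of_sum_le (fun _ => abs_nonneg _) (sum_abs_coord_le x)

theorem tsum_abs_coord_le (x : StrongDual ℝ C₀(ℕ, ℝ)) : ∑' n, |coord x n| ≤ ‖x‖ :=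
  (summable_abs_coord x).tsum_le_of_sum_le (sum_abs_coord_le x)

theorem hasSum_smul_unitVec (f : C₀(ℕ, ℝ)) : HasSum (fun n => f n • unitVec n) f := by
  refine Metric.tendsto_atTop.2 fun ε hε => ?_
  obtain ⟨N, hN⟩ := Metric.tendsto_atTop.1 (c0_tendsto f) (ε / 2) (half_pos hε)
  refine ⟨Finset.range N, fun s hs => ?_⟩
  rw [dist_eq_norm]
  refine (c0_norm_le (half_pos hε).le fun n => ?_).trans_lt (half_lt_self hε)
  rw [ZeroAtInftyContinuousMap.sub_apply, finsetSum_smul_unitVec_apply]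
  split_ifs with hn
  · simpa using (half_pos hε).le
  · have hNn : N ≤ n := by
      by_contra! hlt
      exact hn (hs (Finset.mem_range.2 hlt))
    have := hN n hNn
    rw [Real.dist_eq, sub_zero] at this
    rw [zero_sub, abs_neg]
    exact this.le

theorem hasSum_mul_coord (x : StrongDual ℝ C₀(ℕ, ℝ)) (f : C₀(ℕ, ℝ)) :
    HasSum (fun n => f n * coord x n) (x f) := by
  simpa [coord, Function.comp_def] using x.hasSum (hasSum_smul_unitVec f)

end NullSequences

/-! ### Tails of series and the square of a sum -/

section SumSquare

theorem tsum_Ioi_eq (f : ℕ → ℝ) (n : ℕ) : ∑' i : Set.Ioi n, f i = ∑' k, f (k + (n + 1)) := by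
  have h : Set.Ioi n = Set.range fun k : ℕ => k + (n + 1) := by
    ext m
    simp only [Set.mem_Ioi, Set.mem_range]
    exact ⟨fun hm => ⟨m - (n + 1), by omega⟩, by rintro ⟨k, rfl⟩; omega⟩
  rw [h]
  exact tsum_range f (add_left_injective (n + 1))

theorem tsum_nat_add_eq_add {b : ℕ → ℝ} (hb : Summable b) (n : ℕ) :
    ∑' k, b (k + n) = b n + ∑' k, b (k + (n + 1)) := by
  rw [((summable_nat_add_iff n).2 hb).tsum_eq_zero_add, zero_add]
  simp only [add_assoc, add_comm 1 n]

theorem abs_tsum_nat_add_le_tsum_abs {b : ℕ → ℝ} (hb : Summable fun n => |b n|) (n : ℕ) :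
    |∑' k, b (k + n)| ≤ ∑' k, |b k| := by
  have hs : Summable fun k => ‖b (k + n)‖ := (summable_nat_add_iff n).2 hb
  refine (norm_tsum_le_tsum_norm hs).trans ?_
  rw [← hb.sum_add_tsum_nat_add n]
  exact le_add_of_nonneg_left (Finset.sum_nonneg fun _ _ => abs_nonneg _)

/-- The square of a convergent series, arranged by the smaller of the two indices. -/
theorem eq_tsum_sq_of_hasSum {b : ℕ → ℝ} (hb : Summable b) {s : ℝ}
    (hs : HasSum (fun n => b n * (b n + 2 * ∑' k, b (k + (n + 1)))) s) :
    s = (∑' n, b n) ^ 2 := by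
  -- With `r n` the tail from index `n` on, `b n * (b n + 2 * r (n + 1)) = r n ^ 2 - r (n + 1) ^ 2`,
  -- so the partial sums telescope.
  have hpart : ∀ N, ∑ n ∈ Finset.range N, b n * (b n + 2 * ∑' k, b (k + (n + 1))) =
      (∑' n, b n) ^ 2 - (∑' k, b (k + N)) ^ 2 := by
    intro N
    induction N with
    | zero => simp
    | succ N ih =>
      rw [Finset.sum_range_succ, ih, tsum_nat_add_eq_add hb N]
      ring
  refine tendsto_nhds_unique hs.tendsto_sum_nat ?_
  simp only [hpart]
  simpa using ((tendsto_sum_nat_add b).pow 2).const_sub ((∑' n, b n) ^ 2)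

end SumSquare

/-! ### The operator `A_α` on `ℓ¹` and the functional `α` -/

section Instance

variable (α : lp (fun _ : ℕ => ℝ) ⊤)

theorem abs_apply_le_norm (n : ℕ) : |α n| ≤ ‖α‖ :=
  lp.norm_apply_le_norm ENNReal.top_ne_zero α n

theorem abs_mul_coord_le (x : StrongDual ℝ C₀(ℕ, ℝ)) (n : ℕ) :
    |α n * coord x n| ≤ ‖α‖ * |coord x n| := by
  rw [abs_mul]
  exact mul_le_mul_of_nonneg_right (abs_apply_le_norm α n) (abs_nonneg _)

theorem summable_abs_mul_coord (x : StrongDual ℝ C₀(ℕ, ℝ)) :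
    Summable fun n => |α n * coord x n| :=
  Summable.of_nonneg_of_le (fun _ => abs_nonneg _) (abs_mul_coord_le α x)
    ((summable_abs_coord x).mul_left _)

theorem summable_mul_coord (x : StrongDual ℝ C₀(ℕ, ℝ)) : Summable fun n => α n * coord x n :=
  (summable_abs_mul_coord α x).of_abs

theorem tsum_abs_mul_coord_le (x : StrongDual ℝ C₀(ℕ, ℝ)) :
    ∑' n, |α n * coord x n| ≤ ‖α‖ * ‖x‖ := by
  refine ((summable_abs_mul_coord α x).tsum_le_tsum (abs_mul_coord_le α x)
    ((summable_abs_coord x).mul_left _)).trans ?_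
  rw [tsum_mul_left]
  exact mul_le_mul_of_nonneg_left (tsum_abs_coord_le x) (norm_nonneg _)

theorem abs_tsum_nat_add_le (x : StrongDual ℝ C₀(ℕ, ℝ)) (n : ℕ) :
    |∑' k, α (k + n) * coord x (k + n)| ≤ ‖α‖ * ‖x‖ :=
  (abs_tsum_nat_add_le_tsum_abs (summable_abs_mul_coord α x) n).trans
    (tsum_abs_mul_coord_le α x)

/-- A bounded sequence, as an element of the bidual of `c₀`. -/
noncomputable def boundedFunctional : StrongDual ℝ (StrongDual ℝ C₀(ℕ, ℝ)) :=
  LinearMap.mkContinuous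
    { toFun := fun x => ∑' n, α n * coord x n
      map_add' := fun x y => by
        rw [← (summable_mul_coord α x).tsum_add (summable_mul_coord α y)]
        simp [coord, mul_add]
      map_smul' := fun c x => by
        simp [coord, mul_left_comm, tsum_mul_left] }
    ‖α‖ fun x => by simpa using abs_tsum_nat_add_le α x 0

theorem boundedFunctional_apply (x : StrongDual ℝ C₀(ℕ, ℝ)) :
    boundedFunctional α x = ∑' n, α n * coord x n :=
  rfl

theorem norm_boundedFunctional_le : ‖boundedFunctional α‖ ≤ ‖α‖ :=
  LinearMap.mkContinuous_norm_le _ (norm_nonneg _) _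

theorem hasSum_boundedFunctional (x : StrongDual ℝ C₀(ℕ, ℝ)) :
    HasSum (fun n => α n * coord x n) (boundedFunctional α x) :=
  (summable_mul_coord α x).hasSum

/-- Evaluation at `n`, a unit vector of `ℓ¹`. -/
noncomputable def evalDual (n : ℕ) : StrongDual ℝ C₀(ℕ, ℝ) :=
  LinearMap.mkContinuous
    { toFun := fun f => f n
      map_add' := fun _ _ => rfl
      map_smul' := fun _ _ => rfl }
    1 fun f => by
      rw [one_mul, ← ZeroAtInftyContinuousMap.norm_toBCF_eq_norm]
      exact f.toBCF.norm_coe_le_norm n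

theorem evalDual_apply (n : ℕ) (f : C₀(ℕ, ℝ)) : evalDual n f = f n :=
  rfl

theorem boundedFunctional_evalDual (n : ℕ) : boundedFunctional α (evalDual n) = α n := by
  rw [boundedFunctional_apply, tsum_eq_single n]
  · simp [coord, evalDual_apply, unitVec_apply]
  · intro m hm
    simp [coord, evalDual_apply, unitVec_apply, hm.symm]

/-- Evaluations recover the entries `α n`, so a representing `f ∈ c₀` would have these entries and
force `α n → 0`. -/
theorem boundedFunctional_notMem_range (hα : limsup (fun n => α n) atTop ≠ 0) :
    boundedFunctional α ∉ Set.range (toBidual C₀(ℕ, ℝ)) := by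
  rintro ⟨f, hf⟩
  refine hα (Tendsto.limsup_eq ((c0_tendsto f).congr fun n => ?_))
  rw [← boundedFunctional_evalDual α n, ← hf]
  rfl

/-- The value in `c₀` of the operator `A_α` at a point of the dual of `c₀`. -/
noncomputable def tailVec (x : StrongDual ℝ C₀(ℕ, ℝ)) : C₀(ℕ, ℝ) where
  toFun n := α n * (α n * coord x n + 2 * ∑' k, α (k + (n + 1)) * coord x (k + (n + 1)))
  continuous_toFun := continuous_of_discreteTopology
  zero_at_infty' := by
    rw [cocompact_eq_cofinite, Nat.cofinite_eq_atTop]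
    -- The terms and the tails of a convergent series tend to zero; the outer factor `α n` is merely
    -- bounded.
    have h1 := (summable_mul_coord α x).tendsto_atTop_zero
    have h2 := (tendsto_add_atTop_iff_nat 1).2
      (tendsto_sum_nat_add fun n => α n * coord x n)
    have h3 := h1.add (h2.const_mul 2)
    rw [mul_zero, add_zero] at h3
    exact bdd_le_mul_tendsto_zero' ‖α‖ (Eventually.of_forall (abs_apply_le_norm α)) h3

theorem tailVec_apply (x : StrongDual ℝ C₀(ℕ, ℝ)) (n : ℕ) : tailVec α x n =
    α n * (α n * coord x n + 2 * ∑' k, α (k + (n + 1)) * coord x (k + (n + 1))) :=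
  rfl

theorem norm_tailVec_le (x : StrongDual ℝ C₀(ℕ, ℝ)) : ‖tailVec α x‖ ≤ 3 * ‖α‖ ^ 2 * ‖x‖ := by
  refine c0_norm_le (by positivity) fun n => ?_
  rw [tailVec_apply, abs_mul]
  have h1 : |α n * coord x n| ≤ ‖α‖ * ‖x‖ :=
    ((summable_abs_mul_coord α x).le_tsum n fun _ _ => abs_nonneg _).trans
      (tsum_abs_mul_coord_le α x)
  have h2 := abs_tsum_nat_add_le α x (n + 1)
  have h3 : |α n * coord x n + 2 * ∑' k, α (k + (n + 1)) * coord x (k + (n + 1))| ≤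
      3 * (‖α‖ * ‖x‖) := by
    refine (abs_add_le _ _).trans ?_
    rw [abs_mul 2, abs_two]
    linarith
  calc _ ≤ ‖α‖ * (3 * (‖α‖ * ‖x‖)) :=
        mul_le_mul (abs_apply_le_norm α n) h3 (abs_nonneg _) (norm_nonneg _)
    _ = _ := by ring

theorem summable_nat_add_mul_coord (x : StrongDual ℝ C₀(ℕ, ℝ)) (n : ℕ) :
    Summable fun k => α (k + n) * coord x (k + n) :=
  (summable_nat_add_iff (f := fun n => α n * coord x n) n).2 (summable_mul_coord α x)

/-- The operator `A_α`, with values in `c₀`. -/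
noncomputable def tailMap : StrongDual ℝ C₀(ℕ, ℝ) →L[ℝ] C₀(ℕ, ℝ) :=
  LinearMap.mkContinuous
    { toFun := tailVec α
      map_add' := fun x y => by
        ext n
        have h := (summable_nat_add_mul_coord α x (n + 1)).tsum_add
          (summable_nat_add_mul_coord α y (n + 1))
        rw [ZeroAtInftyContinuousMap.add_apply]
        simp only [tailVec_apply, coord, add_apply, mul_add] at h ⊢
        rw [h]
        ring
      map_smul' := fun c x => by
        ext n
        rw [ZeroAtInftyContinuousMap.smul_apply]
        simp only [tailVec_apply, coord, smul_apply, smul_eq_mul, mul_left_comm _ c,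
          tsum_mul_left, RingHom.id_apply, mul_add] }
    (3 * ‖α‖ ^ 2) (norm_tailVec_le α)

theorem tailMap_apply (x : StrongDual ℝ C₀(ℕ, ℝ)) (n : ℕ) : tailMap α x n =
    α n * (α n * coord x n + 2 * ∑' k, α (k + (n + 1)) * coord x (k + (n + 1))) :=
  rfl

theorem tsum_Ioi_mul_coord (x : StrongDual ℝ C₀(ℕ, ℝ)) (n : ℕ) :
    ∑' i : Set.Ioi n, α n * α i * coord x i =
      α n * ∑' k, α (k + (n + 1)) * coord x (k + (n + 1)) := by
  rw [tsum_Ioi_eq (fun i => α n * α i * coord x i), ← tsum_mul_left]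
  simp only [mul_assoc]

theorem apply_tailMap_self (x : StrongDual ℝ C₀(ℕ, ℝ)) :
    x (tailMap α x) = (boundedFunctional α x) ^ 2 := by
  refine eq_tsum_sq_of_hasSum (summable_mul_coord α x) ?_
  convert hasSum_mul_coord x (tailMap α x) using 2 with n
  rw [tailMap_apply]
  ring

/-- As the whole series sums to zero, its `n`-th term plus the tail beyond `n` is minus the sum over
`i < n`; this absorbs the diagonal term and one of the two tails. -/
theorem neg_tailMap_apply_of_eq_zero {x : StrongDual ℝ C₀(ℕ, ℝ)} (hx : boundedFunctional α x = 0)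
    (n : ℕ) : -(tailMap α x n) = -(∑' i : Set.Ioi n, α n * α i * coord x i) +
      ∑ i ∈ Finset.range n, α n * α i * coord x i := by
  have h1 := (summable_mul_coord α x).sum_add_tsum_nat_add n
  rw [← boundedFunctional_apply, hx, tsum_nat_add_eq_add (summable_mul_coord α x)] at h1
  rw [tsum_Ioi_mul_coord, tailMap_apply]
  simp only [mul_assoc]
  rw [← Finset.mul_sum, eq_neg_of_add_eq_zero_left h1]
  ring

end Instance

end AutoconjugateRepresenter

open AutoconjugateRepresenter
theorem theorem4p8 :
    -- the general result
    (∀ (X : Type*) [NormedAddCommGroup X] [NormedSpace ℝ X] [CompleteSpace X]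
      (A : StrongDual ℝ X →L[ℝ] StrongDual ℝ (StrongDual ℝ X))
      (e : StrongDual ℝ (StrongDual ℝ X)),
      Set.range A ⊆ Set.range (toBidual X) →
      e ∉ Set.range (toBidual X) →
      ‖e‖ < 1 / √2 →
      (∀ x : StrongDual ℝ X, A x x = (e x) ^ 2) →
        opT A e = {a | toBidual X a.1 = -(A a.2) ∧ a.2 ∈ preAnnihilator {e}} ∧
        IsSkewOp (opT A e) ∧
        IsMaximallyMonotoneOp (opT A e) ∧
        (∀ a : StrongDual ℝ X, a ∉ preAnnihilator {e} →
          ∃ x : X, toBidual X x = -(A a) ∧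
            bauschkeWang (opT A e) (x, a) >
              pairConjugate (bauschkeWang (opT A e)) (a, -(A a))) ∧
        ¬ IsAutoconjugate (bauschkeWang (opT A e))) ∧
    -- the instance on `c₀`
    (∀ α : lp (fun _ : ℕ => ℝ) ⊤,
      limsup (fun n => α n) atTop ≠ 0 → ‖α‖ < 1 / √2 →
      (∀ x : StrongDual ℝ C₀(ℕ, ℝ), Summable fun n => |coord x n|) ∧
      ∃ (A : StrongDual ℝ C₀(ℕ, ℝ) →L[ℝ] StrongDual ℝ (StrongDual ℝ C₀(ℕ, ℝ)))
        (e : StrongDual ℝ (StrongDual ℝ C₀(ℕ, ℝ))),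
        -- `A` is the operator `A_α`, with values in `c₀`, and `e` is `α` as an element of `ℓ^∞`
        (∀ x : StrongDual ℝ C₀(ℕ, ℝ), ∃ y : C₀(ℕ, ℝ), A x = toBidual C₀(ℕ, ℝ) y ∧
          ∀ n, y n = (α n) ^ 2 * coord x n + 2 * ∑' i : Set.Ioi n, α n * α i * coord x i) ∧
        (∀ x : StrongDual ℝ C₀(ℕ, ℝ), HasSum (fun n => α n * coord x n) (e x)) ∧
        e ∉ Set.range (toBidual C₀(ℕ, ℝ)) ∧
        ‖e‖ < 1 / √2 ∧
        (∀ x : StrongDual ℝ C₀(ℕ, ℝ), A x x = (e x) ^ 2) ∧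
        -- the explicit form of `T_α`
        opT A e = {a | (∀ n, a.1 n = -(∑' i : Set.Ioi n, α n * α i * coord a.2 i) +
            ∑ i ∈ Finset.range n, α n * α i * coord a.2 i) ∧ a.2 ∈ preAnnihilator {e}} ∧
        IsSkewOp (opT A e) ∧
        IsMaximallyMonotoneOp (opT A e) ∧
        (∀ a : StrongDual ℝ C₀(ℕ, ℝ), a ∉ preAnnihilator {e} →
          ∃ x : C₀(ℕ, ℝ), toBidual C₀(ℕ, ℝ) x = -(A a) ∧
            bauschkeWang (opT A e) (x, a) >
              pairConjugate (bauschkeWang (opT A e)) (a, -(A a))) ∧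
        ¬ IsAutoconjugate (bauschkeWang (opT A e))) := by
  refine ⟨fun X _ _ _ A e hA he hnorm hq => opT_properties hA he hnorm hq, fun α hα hnorm => ?_⟩
  have he := boundedFunctional_notMem_range α hα
  have hnorm' := (norm_boundedFunctional_le α).trans_lt hnorm
  have hq := apply_tailMap_self α
  have hA : Set.range ((toBidual C₀(ℕ, ℝ)).comp (tailMap α)) ⊆ Set.range (toBidual C₀(ℕ, ℝ)) := by
    rintro _ ⟨x, rfl⟩
    exact ⟨tailMap α x, rfl⟩
  obtain ⟨hT, hrest⟩ := opT_properties hA he hnorm' hq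
  refine ⟨summable_abs_coord, (toBidual C₀(ℕ, ℝ)).comp (tailMap α), boundedFunctional α,
    fun x => ⟨tailMap α x, rfl, fun n => ?_⟩, hasSum_boundedFunctional α, he, hnorm', hq, ?_, hrest⟩
  · rw [tsum_Ioi_mul_coord, tailMap_apply]
    ring
  · rw [hT]
    ext ⟨y, x⟩
    refine and_congr_left fun hx => ?_
    have hx' := mem_preAnnihilator_singleton.1 hx
    simp only [← neg_tailMap_apply_of_eq_zero α hx', ContinuousLinearMap.comp_apply]
    rw [← map_neg, toBidual_injective.eq_iff, DFunLike.ext_iff]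
    rfl
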